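/- Let $q\ge 2$ be a prime power, let $p\in(0,1]$ and let $\delta>0$. For $n \ge 1$ let $\mathrm{PG}(n-1,q)$ denote the rank-$n$ projective geometry over the field $\mathrm{GF}(q)$, that is, the matroid whose elements are the points ($1$-dimensional subspaces) of $\mathrm{GF}(q)^n$, and in which a set of points is independent if vectors representing its distinct points are linearly independent. Let $E_p$ be a random set of points of $\mathrm{PG}(n-1,q)$ that contains each point independently with probability $p$, and let $\mathrm{PG}_p(n-1,q)=\mathrm{PG}(n-1,q)|E_p$ be the restriction of the matroid to $E_p$. For a matroid $M$, let $\mathrm{col}(M)$ denote the colouring number of $M$, the smallest $k$ such that the ground set of $M$ can be partitioned into $k$ (possibly empty) independent sets. Then, with $q$, $p$ and $\delta$ fixed, $$\lim_{n\to\infty}\mathbb{P}\left[(1-\delta)\,p\,\frac{q^n}{(q-1)n}\le \mathrm{col}\bigl(\mathrm{PG}_p(n-1,q)\bigr)\le(1+\delta)\,p\,\frac{q^n}{(q-1)n}\right]=1.$$ -/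

import Mathlib

open Filter Topology

namespace RandomPG

/-- A matroid is `k`-colourable if its ground set can be partitioned into `k`
(possibly empty) independent sets. -/
def Colourable {α : Type*} (M : Matroid α) (k : ℕ) : Prop :=
  ∃ I : Fin k → Set α,
    (∀ i, M.Indep (I i)) ∧ Pairwise (fun i j => Disjoint (I i) (I j)) ∧ ⋃ i, I i = M.E

/-- The colouring number: the least `k` such that `M` is `k`-colourable.
(Only meaningful if such a `k` exists, for instance for finite loopless matroids; see
`isLeast_colouringNumber` below for the matroids considered here.) -/
noncomputable def colouringNumber {α : Type*} (M : Matroid α) : ℕ :=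
  sInf {k : ℕ | Colourable M k}

/-- The points of the rank-`n` projective geometry over `F`: one-dimensional subspaces
of `F ^ n`. -/
abbrev Points (n : ℕ) (F : Type*) [Field F] : Type _ :=
  Projectivization F (Fin n → F)

/-- Independence of a set of points is linear independence of representative vectors. -/
theorem independent_iff_linearIndepOn {n : ℕ} {F : Type*} [Field F] (I : Set (Points n F)) :
    Projectivization.Independent (fun x : I => (x : Points n F)) ↔
      LinearIndepOn F Projectivization.rep I :=
  Projectivization.independent_iff

/-- The rank-`n` projective geometry `PG(n-1, F)` over a finite field `F`, as a matroid on the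
set of all points of the projective space; a set of points is independent iff it is independent
in the sense of projective geometry. -/
def PG (n : ℕ) (F : Type*) [Field F] [Finite F] : Matroid (Points n F) :=
  (IndepMatroid.ofFinite (E := Set.univ) Set.finite_univ
    (fun I => Projectivization.Independent (fun x : I => (x : Points n F)))
    (by
      rw [independent_iff_linearIndepOn]
      exact linearIndepOn_empty F _)
    (by
      intro I J hJ hIJ
      rw [independent_iff_linearIndepOn] at hJ ⊢
      exact hJ.mono hIJ)
    (by
      intro I J hI hJ hlt
      rw [independent_iff_linearIndepOn] at hI hJ
      by_contra! hcon
      have hsub : ∀ e ∈ J, Projectivization.rep e ∈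
          Submodule.span F (Projectivization.rep '' I) := by
        intro e he
        by_cases heI : e ∈ I
        · exact Submodule.subset_span ⟨e, heI, rfl⟩
        · have h := hcon e he heI
          rw [independent_iff_linearIndepOn, linearIndepOn_insert heI] at h
          by_contra hn
          exact h ⟨hI, hn⟩
      have hle : Submodule.span F (Projectivization.rep '' J) ≤
          Submodule.span F (Projectivization.rep '' I) := by
        rw [Submodule.span_le]
        rintro _ ⟨e, he, rfl⟩
        exact hsub e he
      have hfin := Submodule.finrank_mono hle
      have key : ∀ K : Set (Points n F), LinearIndepOn F Projectivization.rep K →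
          Module.finrank F (Submodule.span F (Projectivization.rep '' K)) = K.ncard := by
        intro K hK
        have : Fintype K := Fintype.ofFinite K
        have h := finrank_span_eq_card (show LinearIndependent F
          (fun x : K => Projectivization.rep (x : Points n F)) from hK)
        rw [← Nat.card_eq_fintype_card, Nat.card_coe_set_eq] at h
        rw [← h, Set.image_eq_range]
      rw [key J hJ, key I hI] at hfin
      omega)
    (fun _ _ => Set.subset_univ _)).matroid

@[simp] theorem PG_ground (n : ℕ) (F : Type*) [Field F] [Finite F] :
    (PG n F).E = Set.univ := rfl

@[simp] theorem PG_indep_iff {n : ℕ} {F : Type*} [Field F] [Finite F] {I : Set (Points n F)} :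
    (PG n F).Indep I ↔ Projectivization.Independent (fun x : I => (x : Points n F)) := Iff.rfl

/-- The restriction of `PG(n-1, F)` to any set `E` of points has a colouring, namely into
singletons, so that its colouring number is attained. -/
theorem isLeast_colouringNumber (n : ℕ) (F : Type*) [Field F] [Finite F]
    (E : Set (Points n F)) :
    IsLeast {k : ℕ | Colourable ((PG n F).restrict E) k}
      (colouringNumber ((PG n F).restrict E)) := by
  have hne : {k : ℕ | Colourable ((PG n F).restrict E) k}.Nonempty := by
    obtain ⟨e⟩ : Nonempty (Fin (Nat.card E) ≃ E) := ⟨(Finite.equivFin E).symm⟩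
    refine ⟨Nat.card E, fun i => {(e i : Points n F)}, fun i => ?_, fun i j hij => ?_, ?_⟩
    · rw [Matroid.restrict_indep_iff]
      refine ⟨?_, by simp⟩
      rw [PG_indep_iff, independent_iff_linearIndepOn]
      exact LinearIndepOn.singleton (Projectivization.rep_nonzero _)
    · simpa [Subtype.ext_iff] using fun h => hij (e.injective (Subtype.ext h))
    · ext x
      simp only [Set.mem_iUnion, Set.mem_singleton_iff, Matroid.restrict_ground_eq]
      constructor
      · rintro ⟨i, rfl⟩
        exact (e i).2
      · intro hx
        exact ⟨e.symm ⟨x, hx⟩, by rw [e.apply_symm_apply]⟩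
  exact ⟨Nat.sInf_mem hne, fun _ hk => Nat.sInf_le hk⟩

/-- The law of the random set `E_p` of points of `PG(n-1, F)`, in which every point is retained
independently with probability `p`. -/
noncomputable def randomPoints (n : ℕ) (F : Type*) [Field F] (p : unitInterval) :
    MeasureTheory.Measure (Set (Points n F)) :=
  ProbabilityTheory.setBernoulli Set.univ p

end RandomPG

/-!
Write `Q = |F|` and `N = (Q ^ n - 1) / (Q - 1)` for the number of points of `PG(n-1, F)`.

*Lower bound.* An independent set has at most `n` points, so `|E| ≤ n * col`
(`ncard_le_mul_colouringNumber`), and `|E|` is concentrated around `p * N`.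

*Upper bound.* By Edmonds' matroid partition theorem (`exists_colouring_of_card_le_mul`), the
restriction to `E` is `m`-colourable as soon as `|X| ≤ m * r(X)` for all `X ⊆ E`. The partition
theorem follows from Rado's theorem on independent transversals
(`exists_transversal_of_submodular`), applied to `m` disjoint copies of the matroid. It
remains to check the inequality for `m` the integer part of `(1 + δ) p Q ^ n / ((Q - 1) n)`
(`colouringNumber_le_of_regular`). Let `k = r(X)`.
* If `2 * k ≤ n`, then `|X| ≤ Q ^ k ≤ Q ^ (n / 2) ≤ m` for large `n`, whatever `E` is.
* If `2 * k > n`, let `W` be the span of `X`. If every subspace `W` contains at most its expected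
  number of points of `E` plus `ε * N`, with `ε = δ * p / 4`, the inequality follows from
  `Q ^ k / k ≤ Q ^ n / n`, the error term being absorbed because `n ≤ 2 * k`.

Finally `E` has this regularity with high probability (`randomPoints_irregular_le`): by Hoeffding's
inequality a given subspace fails with probability at most `exp (-2 ε² N)`, which is doubly
exponentially small in `n`, whereas there are at most `Q ^ (n ^ 2)` subspaces.
-/

namespace RandomPG

open MeasureTheory ProbabilityTheory

/-! ### Rado's theorem and matroid partition -/

/-- **Rado's theorem** for a monotone submodular function `f`: under the Hall-type condition that
any set `X` of indices satisfies `|X| ≤ f (⋃ i ∈ X, A i)`, the family `A` has a transversal that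
satisfies the same condition. When `f` is a matroid rank function, this transversal is
independent. As long as some `A i` has two elements, one of the two can be discarded: two witnesses
against this would contradict submodularity. -/
theorem exists_transversal_of_submodular {ι β : Type*} [Fintype ι] [DecidableEq ι] [DecidableEq β]
    (f : Finset β → ℕ) (hf0 : f ∅ = 0) (hmono : Monotone f)
    (hsub : ∀ s t, f (s ∩ t) + f (s ∪ t) ≤ f s + f t)
    (A : ι → Finset β) (hA : ∀ X : Finset ι, X.card ≤ f (X.biUnion A)) :
    ∃ a : ι → β, (∀ i, a i ∈ A i) ∧ ∀ X : Finset ι, X.card ≤ f (X.image a) := by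
  induction hN : ∑ i, (A i).card using Nat.strong_induction_on generalizing A with
  | _ N ih =>
  by_cases hone : ∀ i, (A i).card ≤ 1
  · have hex : ∀ i, ∃ b, A i = {b} := fun i => by
      rw [← Finset.card_eq_one]
      refine le_antisymm (hone i) (Finset.card_pos.2 (Finset.nonempty_iff_ne_empty.2 fun h => ?_))
      simpa [h, hf0] using hA {i}
    choose a ha using hex
    refine ⟨a, fun i => by simp [ha], fun X => ?_⟩
    have : X.biUnion A = X.image a := by ext; simp [ha, eq_comm]
    exact this ▸ hA X
  push Not at hone
  obtain ⟨i, hi⟩ := hone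
  obtain ⟨x, hx, y, hy, hxy⟩ := Finset.one_lt_card.1 hi
  -- It suffices that some element of `A i` can be discarded without violating the Hall condition.
  suffices h : ∃ z ∈ A i, ∀ X : Finset ι,
      X.card ≤ f (X.biUnion (Function.update A i ((A i).erase z))) by
    obtain ⟨z, hz, hX⟩ := h
    have hle : ∀ j, Function.update A i ((A i).erase z) j ⊆ A j := fun j => by
      by_cases hj : j = i
      · subst hj; simpa using Finset.erase_subset _ _
      · simp [hj]
    obtain ⟨a, ha, ha'⟩ := ih _ (by
      rw [← hN]
      refine Finset.sum_lt_sum (fun j _ => Finset.card_le_card (hle j)) ⟨i, Finset.mem_univ _, ?_⟩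
      simpa using Finset.card_erase_lt_of_mem hz) _ hX rfl
    exact ⟨a, fun j => hle j (ha j), ha'⟩
  by_contra! hcon
  -- A set that violates the condition after `z` is discarded has to contain `i`.
  have key : ∀ z ∈ A i, ∃ X : Finset ι, i ∉ X ∧
      f (X.biUnion A ∪ (A i).erase z) ≤ X.card := by
    intro z hz
    obtain ⟨X, hX⟩ := hcon z hz
    have hupd : ∀ j ∈ X.erase i, Function.update A i ((A i).erase z) j = A j := fun j hj => by
      simp [Finset.ne_of_mem_erase hj]
    have hiX : i ∈ X := by
      by_contra hiX
      rw [Finset.erase_eq_of_notMem hiX] at hupd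
      rw [Finset.biUnion_congr rfl hupd] at hX
      exact absurd (hA X) (not_le.2 hX)
    refine ⟨X.erase i, by simp, ?_⟩
    rw [← Finset.insert_erase hiX, Finset.biUnion_insert, Finset.biUnion_congr rfl hupd,
      Finset.card_insert_of_notMem (by simp), Function.update_self, Finset.union_comm] at hX
    omega
  obtain ⟨X, hiX, hX⟩ := key x hx
  obtain ⟨Y, hiY, hY⟩ := key y hy
  -- The union of the two sets below covers `A i`, as `x ≠ y`; so the Hall condition for
  -- `insert i (X ∪ Y)` and `X ∩ Y` exceeds by one what submodularity allows.
  have h1 := hA (insert i (X ∪ Y))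
  have h2 := hA (X ∩ Y)
  have h3 := hsub (X.biUnion A ∪ (A i).erase x) (Y.biUnion A ∪ (A i).erase y)
  have h4 : f ((insert i (X ∪ Y)).biUnion A) ≤
      f ((X.biUnion A ∪ (A i).erase x) ∪ (Y.biUnion A ∪ (A i).erase y)) := hmono <| by
    intro b hb
    simp only [Finset.mem_biUnion, Finset.mem_insert, Finset.mem_union, Finset.mem_erase] at hb ⊢
    obtain ⟨j, rfl | hj | hj, hb⟩ := hb
    · by_cases hbx : b = x
      · exact Or.inr (Or.inr ⟨hbx ▸ hxy, hb⟩)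
      · exact Or.inl (Or.inr ⟨hbx, hb⟩)
    · exact Or.inl (Or.inl ⟨j, hj, hb⟩)
    · exact Or.inr (Or.inl ⟨j, hj, hb⟩)
  have h5 : f ((X ∩ Y).biUnion A) ≤
      f ((X.biUnion A ∪ (A i).erase x) ∩ (Y.biUnion A ∪ (A i).erase y)) := hmono <| by
    intro b hb
    simp only [Finset.mem_biUnion, Finset.mem_inter, Finset.mem_union] at hb ⊢
    obtain ⟨j, ⟨hj, hj'⟩, hb⟩ := hb
    exact ⟨Or.inl ⟨j, hj, hb⟩, Or.inl ⟨j, hj', hb⟩⟩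
  rw [Finset.card_insert_of_notMem (by simp [hiX, hiY])] at h1
  have h6 := Finset.card_union_add_card_inter X Y
  omega

/-- **Edmonds' matroid partition theorem**, for a monotone submodular function `r` in place of the
rank: if `|X| ≤ m * r X` for all `X ⊆ E`, then `E` can be coloured with `m` colours so that
`|X| ≤ r X` for every monochromatic `X`, that is, with independent colour classes when `r` is a
matroid rank function. -/
theorem exists_colouring_of_card_le_mul {α : Type*} [DecidableEq α] (r : Finset α → ℕ)
    (hr0 : r ∅ = 0) (hmono : Monotone r) (hsub : ∀ s t, r (s ∩ t) + r (s ∪ t) ≤ r s + r t)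
    (E : Finset α) (m : ℕ) (hE : ∀ X ⊆ E, X.card ≤ m * r X) :
    ∃ c : E → Fin m, ∀ k, ∀ X : Finset E, (∀ x ∈ X, c x = k) →
      X.card ≤ r (X.image Subtype.val) := by
  -- Rado's theorem is applied to `m` disjoint copies of `E`, the element `e` being offered its `m`
  -- copies; `fib S k` is the part of `S` in the copy `k`, and the rank of `S` is the sum of the
  -- ranks of these parts.
  let fib : Finset (α × Fin m) → Fin m → Finset α := fun S k =>
    (S.filter (fun z => z.2 = k)).image Prod.fst
  have mem_fib : ∀ S k e, e ∈ fib S k ↔ (e, k) ∈ S := by simp [fib]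
  obtain ⟨a, ha, ha'⟩ := exists_transversal_of_submodular (ι := E)
    (fun S => ∑ k, r (fib S k)) (by simp [fib, hr0])
    (fun S T hST => Finset.sum_le_sum fun k _ => hmono fun e he => by
      rw [mem_fib] at he ⊢; exact hST he)
    (fun S T => by
      simp only [← Finset.sum_add_distrib]
      refine Finset.sum_le_sum fun k _ => ?_
      have h1 : fib (S ∩ T) k = fib S k ∩ fib T k := by ext; simp [mem_fib]
      have h2 : fib (S ∪ T) k = fib S k ∪ fib T k := by ext; simp [mem_fib]
      rw [h1, h2]
      exact hsub _ _)
    (fun e => {(e : α)} ×ˢ Finset.univ) (fun X => by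
      have hX : ∀ k, fib (X.biUnion fun e => {(e : α)} ×ˢ Finset.univ) k =
          X.image Subtype.val := fun k => by ext; simp [mem_fib, eq_comm]
      have := hE (X.image Subtype.val) (by intro; simp; tauto)
      rw [Finset.card_image_of_injective _ Subtype.val_injective] at this
      simp only [hX, Finset.sum_const, Finset.card_univ, Fintype.card_fin, smul_eq_mul]
      exact this)
  have ha1 : ∀ e, (a e).1 = e := fun e => by
    simpa using (Finset.mem_product.1 (ha e)).1
  refine ⟨fun e => (a e).2, fun k X hX => (ha' X).trans_eq ?_⟩
  have hne : ∀ l, l ≠ k → fib (X.image a) l = ∅ := fun l hl => by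
    ext e
    simp only [mem_fib, Finset.mem_image, Finset.notMem_empty, iff_false, not_exists, not_and]
    intro x hx hxe
    exact hl (by simpa [hxe] using hX x hx)
  have heq : fib (X.image a) k = X.image Subtype.val := by
    ext e
    simp only [mem_fib, Finset.mem_image]
    constructor
    · rintro ⟨x, hx, hxe⟩
      exact ⟨x, hx, by rw [← ha1 x, hxe]⟩
    · rintro ⟨x, hx, rfl⟩
      exact ⟨x, hx, Prod.ext (ha1 x) (hX x hx)⟩
  rw [Finset.sum_eq_single k (fun l _ hl => by rw [hne l hl, hr0]) (by simp), heq]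

/-! ### Hoeffding's inequality for Bernoulli random sets -/

/-- **Hoeffding's inequality** for the number of points that a Bernoulli random set has in a finite
set `s`, for both tails. The bound is given in terms of an upper bound `M` of the size of `s`, so
that it can be made uniform in `s`. -/
theorem setBernoulli_real_hoeffding {ι : Type*} (p : unitInterval) (s : Finset ι)
    {M : ℕ} (hsM : s.card ≤ M) {t : ℝ} (ht : 0 < t) :
    (setBernoulli (Set.univ : Set ι) p).real
        {E | (p : ℝ) * s.card + t ≤ ((E ∩ s).ncard : ℝ)} ≤ Real.exp (-2 * t ^ 2 / M) ∧
    (setBernoulli (Set.univ : Set ι) p).real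
        {E | ((E ∩ s).ncard : ℝ) ≤ (p : ℝ) * s.card - t} ≤ Real.exp (-2 * t ^ 2 / M) := by
  classical
  rcases s.eq_empty_or_nonempty with rfl | hs
  · simp [ht.not_ge, Real.exp_nonneg]
  have hs0 : (0 : ℝ) < s.card := by exact_mod_cast hs.card_pos
  -- The indicator of each point is a bounded function of one coordinate of a product measure.
  let ν : Measure Prop := unitInterval.toNNReal p • Measure.dirac True +
    unitInterval.toNNReal (unitInterval.symm p) • Measure.dirac False
  let P : Measure (ι → Prop) := Measure.infinitePi fun _ => ν
  have : IsProbabilityMeasure ν := by infer_instance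
  let g : Prop → ℝ := fun a => if a then 1 else 0
  have hg : Measurable g := measurable_from_top
  have hgI : ∀ a, g a ∈ Set.Icc (0 : ℝ) 1 := fun a => by
    by_cases h : a <;> simp [g, h]
  have hgm : ∀ i, Measurable (fun ω : ι → Prop => g (ω i)) := fun i =>
    hg.comp (measurable_pi_apply i)
  have hgint : ∀ (μ : Measure Prop) [IsFiniteMeasure μ], Integrable g μ := fun μ _ =>
    Integrable.of_mem_Icc 0 1 hg.aemeasurable (Eventually.of_forall hgI)
  have hint : ∀ i, ∫ ω, g (ω i) ∂P = p := fun i => by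
    have h1 : ∫ ω, g (ω i) ∂P = ∫ a, g a ∂ν := by
      rw [← Measure.infinitePi_map_eval (fun _ : ι => ν) i,
        integral_map (measurable_pi_apply i).aemeasurable hg.aestronglyMeasurable]
    rw [h1, integral_add_measure (hgint _) (hgint _), integral_smul_nnreal_measure,
      integral_smul_nnreal_measure]
    simp [g, NNReal.smul_def]
  have hind : iIndepFun (fun i ω => g (ω i) - p) P :=
    iIndepFun_infinitePi (P := fun _ : ι => ν) (X := fun _ a => g a - p)
      (fun _ => hg.sub_const _)
  have hsg : ∀ i, HasSubgaussianMGF (fun ω : ι → Prop => g (ω i) - p)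
      ((‖(1 : ℝ) - 0‖₊ / 2) ^ 2) P := fun i => by
    rw [← hint i]
    exact hasSubgaussianMGF_of_mem_Icc (hgm i).aemeasurable (Eventually.of_forall fun ω => hgI _)
  have hcount : ∀ ω : ι → Prop, (({i | ω i} ∩ s : Set ι).ncard : ℝ) = ∑ i ∈ s, g (ω i) :=
    fun ω => by
      have : ({i | ω i} ∩ s : Set ι) = (s.filter ω : Finset ι) := by ext; simp [and_comm]
      rw [this, Set.ncard_coe_finset]
      simp [g]
  have hexp : Real.exp (-t ^ 2 / (2 * ((∑ i ∈ s, (‖(1 : ℝ) - 0‖₊ / 2) ^ 2 : NNReal) : ℝ))) ≤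
      Real.exp (-2 * t ^ 2 / M) := by
    have h1 : -t ^ 2 / (2 * ((∑ i ∈ s, (‖(1 : ℝ) - 0‖₊ / 2) ^ 2 : NNReal) : ℝ)) =
        -(2 * t ^ 2 / s.card) := by
      simp
      ring
    rw [h1, neg_mul, neg_div]
    gcongr
  have hsum : ∀ ω : ι → Prop, ∑ i ∈ s, (g (ω i) - p) = ∑ i ∈ s, g (ω i) - p * s.card := by
    intro ω; simp [mul_comm]
  have hsg2 := HasSubgaussianMGF.sum_of_iIndepFun hind (fun i (_ : i ∈ s) => hsg i)
  simp only [measureReal_def, setBernoulli_apply', Set.mem_univ]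
  constructor
  · refine le_trans (le_of_eq ?_) ((hsg2.measure_ge_le ht.le).trans hexp)
    rw [measureReal_def]
    congr 2
    ext ω
    simp only [Set.preimage_ofPred_eq, Set.mem_ofPred_eq]
    rw [hcount, hsum]
    constructor <;> intro h <;> linarith
  · refine le_trans (le_of_eq ?_) ((hsg2.neg.measure_ge_le ht.le).trans hexp)
    rw [measureReal_def]
    congr 2
    ext ω
    simp only [Set.preimage_ofPred_eq, Set.mem_ofPred_eq, Pi.neg_apply]
    rw [hcount, hsum]
    constructor <;> intro h <;> linarith

/-! ### Colouring restrictions of projective geometries -/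

section Linear

variable {n : ℕ} {F : Type*} [Field F] [Finite F]

/-- The set of points of a linear subspace `W`. -/
noncomputable def pointsOf (W : Submodule F (Fin n → F)) : Finset (Points n F) :=
  (Set.toFinite {x : Points n F | x.rep ∈ W}).toFinset

theorem card_pointsOf_mul_add_one_le (W : Submodule F (Fin n → F)) :
    (pointsOf W).card * (Nat.card F - 1) + 1 ≤ Nat.card F ^ Module.finrank F W := by
  rw [← Module.natCard_eq_pow_finrank (K := F) (V := W), Projectivization.card' F W]
  gcongr
  let ι : Projectivization F W → Points n F :=
    Projectivization.map W.subtype W.subtype_injective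
  have hsub : (pointsOf W : Set (Points n F)) ⊆ Set.range ι := fun x hx => by
    have hx : x.rep ∈ W := by simpa [pointsOf] using hx
    refine ⟨Projectivization.mk F ⟨x.rep, hx⟩ fun h => x.rep_nonzero (by simpa using h), ?_⟩
    simp only [ι, Projectivization.map_mk]
    exact x.mk_rep
  calc (pointsOf W).card = (pointsOf W : Set (Points n F)).ncard := (Set.ncard_coe_finset _).symm
    _ ≤ (Set.range ι).ncard := Set.ncard_le_ncard hsub (Set.toFinite _)
    _ ≤ Nat.card (Projectivization F W) := by
      rw [← Set.image_univ, ← Set.ncard_univ]; exact Set.ncard_image_le (Set.toFinite _)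

theorem colouringNumber_restrict_le (E : Set (Points n F)) (m : ℕ)
    (hE : ∀ X : Finset (Points n F), (X : Set (Points n F)) ⊆ E →
      X.card ≤ m * Module.finrank F
        (Submodule.span F (Projectivization.rep '' (X : Set (Points n F))))) :
    colouringNumber ((PG n F).restrict E) ≤ m := by
  classical
  let r : Finset (Points n F) → ℕ := fun X =>
    Module.finrank F (Submodule.span F (Projectivization.rep '' (X : Set (Points n F))))
  let E' : Finset (Points n F) := (Set.toFinite E).toFinset
  have hmono : Monotone r := fun s t hst =>
    Submodule.finrank_mono (Submodule.span_mono (Set.image_mono hst))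
  obtain ⟨c, hc⟩ := exists_colouring_of_card_le_mul r (by simp [r]) hmono (fun s t => by
      have h := Submodule.finrank_sup_add_finrank_inf_eq
        (Submodule.span F (Projectivization.rep '' (s : Set (Points n F))))
        (Submodule.span F (Projectivization.rep '' (t : Set (Points n F))))
      rw [← Submodule.span_union, ← Set.image_union, ← Finset.coe_union] at h
      have h' : r (s ∩ t) ≤ _ := Submodule.finrank_mono (le_inf
        (Submodule.span_mono (R := F) (Set.image_mono (f := Projectivization.rep)
          (Finset.coe_subset.2 (Finset.inter_subset_left (s₁ := s) (s₂ := t)))))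
        (Submodule.span_mono (R := F) (Set.image_mono (f := Projectivization.rep)
          (Finset.coe_subset.2 (Finset.inter_subset_right (s₁ := s) (s₂ := t))))))
      simp only [r] at h' ⊢
      omega) E' m
    (fun X hX => hE X fun x hx => by simpa [E'] using hX hx)
  refine (isLeast_colouringNumber n F E).2 ⟨fun k => {x | ∃ h : x ∈ E', c ⟨x, h⟩ = k}, ?_, ?_, ?_⟩
  · intro k
    rw [Matroid.restrict_indep_iff, PG_indep_iff, independent_iff_linearIndepOn]
    refine ⟨?_, fun x ⟨hx, _⟩ => by simpa [E'] using hx⟩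
    let X : Finset E' := Finset.univ.filter fun x => c x = k
    have hX := hc k X (by simp [X])
    have hset : {x | ∃ h : x ∈ E', c ⟨x, h⟩ = k} = (X.image Subtype.val : Finset _) := by
      ext; simp [X]
    beta_reduce
    rw [hset]
    rw [← Finset.card_image_of_injective _ Subtype.val_injective] at hX
    refine linearIndependent_iff_card_le_finrank_span.2 ?_
    simp only [r] at hX
    rw [Set.image_eq_range] at hX
    simpa [Set.finrank] using hX
  · intro k l hkl
    rw [Set.disjoint_left]
    rintro x ⟨h, rfl⟩ ⟨_, rfl⟩
    exact hkl rfl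
  · ext x
    simp [E']

theorem ncard_le_mul_colouringNumber (E : Set (Points n F)) :
    E.ncard ≤ n * colouringNumber ((PG n F).restrict E) := by
  obtain ⟨I, hI, -, hU⟩ := (isLeast_colouringNumber n F E).1
  have hcard : ∀ k, (I k).ncard ≤ n := fun k => by
    have h := (hI k).of_restrict
    rw [PG_indep_iff, independent_iff_linearIndepOn] at h
    have : Fintype (I k) := Fintype.ofFinite _
    have h' := LinearIndependent.fintype_card_le_finrank h
    rw [← Nat.card_eq_fintype_card, Nat.card_coe_set_eq] at h'
    simpa using h'
  have hU : ⋃ k, I k = E := hU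
  calc E.ncard = (⋃ k, I k).ncard := by rw [hU]
    _ ≤ ∑ k, (I k).ncard := Set.ncard_iUnion_le_of_fintype _
    _ ≤ ∑ _k : Fin _, n := Finset.sum_le_sum fun k _ => hcard k
    _ = _ := by simp [mul_comm]

/-- A subspace of `F ^ n` is spanned by `n` vectors, which bounds the number of subspaces. -/
theorem card_submodule_le : Nat.card (Submodule F (Fin n → F)) ≤ Nat.card F ^ n ^ 2 := by
  have hsurj : Function.Surjective
      (fun v : Fin n → Fin n → F => Submodule.span F (Set.range v)) := fun W => by
    obtain ⟨f, hf⟩ : ∃ f : (Fin n → F) →ₗ[F] (Fin n → F), LinearMap.range f = W := by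
      obtain ⟨f, hf⟩ := W.subtype.exists_leftInverse_of_injective W.ker_subtype
      refine ⟨W.subtype ∘ₗ f, ?_⟩
      have : Function.Surjective f := fun w => ⟨w, LinearMap.congr_fun hf w⟩
      rw [LinearMap.range_comp, LinearMap.range_eq_top.2 this, Submodule.map_top, W.range_subtype]
    refine ⟨fun i => f (Pi.basisFun F (Fin n) i), ?_⟩
    simp only
    rw [← Function.comp_def f, Set.range_comp, ← Submodule.map_span, Module.Basis.span_eq,
      Submodule.map_top, hf]
  refine (Nat.card_le_card_of_surjective _ hsurj).trans_eq ?_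
  simp [Nat.card_fun, ← pow_mul, sq]

end Linear

/-! ### Counting estimates and concentration -/

section Asymptotics

variable {n : ℕ} {F : Type*} [Field F] [Finite F]

theorem card_points_mul (n : ℕ) (F : Type*) [Field F] [Finite F] :
    (Nat.card (Points n F) : ℝ) * ((Nat.card F : ℝ) - 1) = (Nat.card F : ℝ) ^ n - 1 := by
  have h := Projectivization.card' F (Fin n → F)
  have hq : 1 ≤ Nat.card F := Finite.card_pos
  simp only [Nat.card_fun, Nat.card_fin] at h
  have h' : (Nat.card F : ℝ) ^ n =
      Nat.card (Points n F) * ((Nat.card F - 1 : ℕ) : ℝ) + 1 := by exact_mod_cast h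
  rw [h', Nat.cast_sub hq]
  simp

theorem card_pointsOf_mul_le (W : Submodule F (Fin n → F)) :
    ((pointsOf W).card : ℝ) * ((Nat.card F : ℝ) - 1) ≤
      (Nat.card F : ℝ) ^ Module.finrank F W := by
  have hq : 1 ≤ Nat.card F := Finite.card_pos
  have h : ((pointsOf W).card : ℝ) * ((Nat.card F - 1 : ℕ) : ℝ) + 1 ≤
      (Nat.card F : ℝ) ^ Module.finrank F W := by
    exact_mod_cast card_pointsOf_mul_add_one_le W
  rw [Nat.cast_sub hq] at h
  simp only [Nat.cast_one] at h
  linarith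

theorem mul_pow_le_mul_pow_of_le {Q : ℝ} (hQ : 2 ≤ Q) {k n : ℕ} (hk : 1 ≤ k) (hkn : k ≤ n) :
    (n : ℝ) * Q ^ k ≤ k * Q ^ n := by
  induction n, hkn using Nat.le_induction with
  | base => rfl
  | succ n hn ih =>
    have h1 : (1 : ℝ) ≤ n := by exact_mod_cast hk.trans hn
    have h2 : (0 : ℝ) ≤ Q ^ k := by positivity
    have h3 : (0 : ℝ) ≤ k * Q ^ n := by positivity
    calc ((n + 1 : ℕ) : ℝ) * Q ^ k ≤ 2 * (n * Q ^ k) := by push_cast; nlinarith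
      _ ≤ 2 * (k * Q ^ n) := by gcongr
      _ ≤ Q * (k * Q ^ n) := by gcongr
      _ = k * Q ^ (n + 1) := by ring

/-- If no subspace contains many more points of `E` than the proportion `p` of its points, then the
matroid partition theorem colours `E` with the required number of colours. -/
theorem colouringNumber_le_of_regular {p δ : ℝ} (hp : 0 ≤ p) (hδ : 0 ≤ δ) (hn : 0 < n)
    (E : Set (Points n F))
    (hreg : ∀ W : Submodule F (Fin n → F), ((E ∩ pointsOf W).ncard : ℝ) ≤
      p * (pointsOf W).card + δ * p / 4 * Nat.card (Points n F))
    (h₁ : ((Nat.card F : ℝ) - 1) * n * (Nat.card F : ℝ) ^ (n / 2) ≤ p * (Nat.card F : ℝ) ^ n)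
    (h₂ : n * ((Nat.card F : ℝ) - 1) ≤ δ * p / 2 * (Nat.card F : ℝ) ^ n) :
    (colouringNumber ((PG n F).restrict E) : ℝ) ≤
      (1 + δ) * (p * ((Nat.card F : ℝ) ^ n / (((Nat.card F : ℝ) - 1) * n))) := by
  have hQ : (2 : ℝ) ≤ Nat.card F := by exact_mod_cast Finite.one_lt_card (α := F)
  have hNQ := card_points_mul n F
  set Q : ℝ := (Nat.card F : ℝ)
  set N : ℝ := (Nat.card (Points n F) : ℝ)
  have hQ1 : 0 < Q - 1 := by linarith
  have hn0 : (0 : ℝ) < n := by exact_mod_cast hn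
  set T : ℝ := (1 + δ) * (p * (Q ^ n / ((Q - 1) * n))) with hT
  have hT0 : 0 ≤ T := by positivity
  have hTmul : T * ((Q - 1) * n) = (1 + δ) * p * Q ^ n := by rw [hT]; field_simp
  refine le_trans ?_ (Nat.floor_le hT0)
  have hfloor : T - 1 ≤ (⌊T⌋₊ : ℝ) := (Nat.sub_one_lt_floor T).le
  refine Nat.cast_le.2 (colouringNumber_restrict_le E _ fun X hXE => ?_)
  set W := Submodule.span F (Projectivization.rep '' (X : Set (Points n F)))
  set k := Module.finrank F W
  have hXW : (X : Set (Points n F)) ⊆ pointsOf W := fun x hx => by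
    have : x.rep ∈ W := Submodule.subset_span ⟨x, hx, rfl⟩
    simpa [pointsOf] using this
  have hkn : k ≤ n := (Submodule.finrank_le W).trans_eq (by simp)
  have hW := card_pointsOf_mul_le W
  have hXcard : (X.card : ℝ) ≤ (pointsOf W).card := by
    exact_mod_cast Finset.card_le_card (Finset.coe_subset.1 hXW)
  rcases Nat.eq_zero_or_pos k with hk | hk
  · have h := card_pointsOf_mul_add_one_le W
    have hq : 0 < Nat.card F - 1 := Nat.sub_pos_of_lt Finite.one_lt_card
    rw [show Module.finrank F W = 0 from hk, pow_zero] at h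
    have h0 : (pointsOf W).card = 0 := by
      by_contra hne
      have := Nat.mul_pos (Nat.pos_of_ne_zero hne) hq
      omega
    have : X.card = 0 := by
      rw [h0] at hXcard
      exact Nat.le_zero.1 (by exact_mod_cast hXcard)
    omega
  have hk1 : (1 : ℝ) ≤ k := by exact_mod_cast hk
  by_cases hkn2 : 2 * k ≤ n
  -- Small rank: all points of the span together are few enough.
  · have hXk : X.card ≤ Nat.card F ^ k := by
      have : (X.card : ℝ) ≤ Q ^ k := by
        have : (0 : ℝ) ≤ (pointsOf W).card := by positivity
        nlinarith
      rw [← Nat.cast_pow] at this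
      exact Nat.cast_le.1 this
    refine hXk.trans (le_trans (Nat.le_floor ?_) (Nat.le_mul_of_pos_right _ hk))
    have hkhalf : Q ^ k ≤ Q ^ (n / 2) := pow_le_pow_right₀ (by linarith) (by omega)
    push_cast
    change Q ^ k ≤ T
    refine le_of_mul_le_mul_right ?_ (mul_pos hQ1 hn0)
    rw [hTmul]
    calc Q ^ k * ((Q - 1) * n) ≤ Q ^ (n / 2) * ((Q - 1) * n) := by gcongr
      _ = (Q - 1) * n * Q ^ (n / 2) := by ring
      _ ≤ p * Q ^ n := h₁
      _ ≤ (1 + δ) * p * Q ^ n := by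
        have : 0 ≤ δ * (p * Q ^ n) := by positivity
        linarith
  -- Large rank: the regularity of `E` is used, with `Q ^ k / k ≤ Q ^ n / n` for the mean.
  · have hn2k : (n : ℝ) ≤ 2 * k := by exact_mod_cast (by omega : n ≤ 2 * k)
    have hXE' : (X.card : ℝ) ≤ (E ∩ pointsOf W).ncard := by
      rw [← Set.ncard_coe_finset X]
      exact_mod_cast Set.ncard_le_ncard (Set.subset_inter hXE hXW) (Set.toFinite _)
    have hmon := mul_pow_le_mul_pow_of_le hQ hk hkn
    have hmain : (X.card : ℝ) * ((Q - 1) * n) ≤ k * (T - 1) * ((Q - 1) * n) := by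
      calc (X.card : ℝ) * ((Q - 1) * n)
          ≤ (p * (pointsOf W).card + δ * p / 4 * N) * ((Q - 1) * n) := by
            gcongr; exact hXE'.trans (hreg W)
        _ = n * (p * ((pointsOf W).card * (Q - 1)) + δ * p / 4 * (N * (Q - 1))) := by ring
        _ ≤ n * (p * Q ^ k + δ * p / 4 * Q ^ n) := by
            rw [hNQ]; gcongr; linarith
        _ = p * (n * Q ^ k) + n * (δ * p / 4 * Q ^ n) := by ring
        _ ≤ p * (k * Q ^ n) + 2 * k * (δ * p / 4 * Q ^ n) := by gcongr
        _ = k * ((1 + δ) * p * Q ^ n - δ * p / 2 * Q ^ n) := by ring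
        _ ≤ k * ((1 + δ) * p * Q ^ n - n * (Q - 1)) := by gcongr
        _ = k * (T - 1) * ((Q - 1) * n) := by rw [← hTmul]; ring
    have hle : (X.card : ℝ) ≤ ⌊T⌋₊ * k :=
      calc (X.card : ℝ) ≤ k * (T - 1) := le_of_mul_le_mul_right hmain (mul_pos hQ1 hn0)
        _ ≤ k * ⌊T⌋₊ := by gcongr
        _ = _ := by ring
    exact_mod_cast hle

theorem le_colouringNumber_of_le_ncard {p δ : ℝ} (hp : 0 ≤ p) (hδ : 0 ≤ δ) (hn : 0 < n)
    (E : Set (Points n F))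
    (hE : (p - δ * p / 4) * Nat.card (Points n F) ≤ (E.ncard : ℝ))
    (h : 1 ≤ δ / 2 * (Nat.card F : ℝ) ^ n) :
    (1 - δ) * (p * ((Nat.card F : ℝ) ^ n / (((Nat.card F : ℝ) - 1) * n))) ≤
      (colouringNumber ((PG n F).restrict E) : ℝ) := by
  have hQ : (2 : ℝ) ≤ Nat.card F := by exact_mod_cast Finite.one_lt_card (α := F)
  have hNQ := card_points_mul n F
  set Q : ℝ := (Nat.card F : ℝ)
  set N : ℝ := (Nat.card (Points n F) : ℝ)
  have hQ1 : 0 < Q - 1 := by linarith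
  have hn0 : (0 : ℝ) < n := by exact_mod_cast hn
  have hcol : (E.ncard : ℝ) ≤ n * colouringNumber ((PG n F).restrict E) := by
    exact_mod_cast ncard_le_mul_colouringNumber E
  refine le_of_mul_le_mul_right ?_ (mul_pos hQ1 hn0)
  calc (1 - δ) * (p * (Q ^ n / ((Q - 1) * n))) * ((Q - 1) * n)
      = p * ((1 - δ) * Q ^ n) := by field_simp
    _ ≤ p * ((1 - δ / 4) * (Q ^ n - 1)) := by
      refine mul_le_mul_of_nonneg_left ?_ hp
      have : 0 ≤ δ * Q ^ n := by positivity
      linarith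
    _ = (p - δ * p / 4) * N * (Q - 1) := by rw [← hNQ]; ring
    _ ≤ (n * colouringNumber ((PG n F).restrict E)) * (Q - 1) := by
      exact mul_le_mul_of_nonneg_right (hE.trans hcol) hQ1.le
    _ = _ := by ring

/-- The probability that the number of random points in some subspace exceeds its mean by
`ε * N`, or that the total number of random points falls short of its mean by `ε * N`, where `N` is
the number of all points. -/
theorem randomPoints_irregular_le (n : ℕ) (F : Type*) [Field F] [Finite F] (p : unitInterval)
    {ε : ℝ} (hε : 0 < ε) (hn : 0 < n) :
    (randomPoints n F p).real
      {E | ¬ ((∀ W : Submodule F (Fin n → F), ((E ∩ pointsOf W).ncard : ℝ) ≤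
          p * (pointsOf W).card + ε * Nat.card (Points n F)) ∧
        (p - ε) * Nat.card (Points n F) ≤ (E.ncard : ℝ))} ≤
      2 * ((Nat.card F : ℝ) ^ n ^ 2 * Real.exp (-(2 * ε ^ 2 * Nat.card (Points n F)))) := by
  classical
  have : Fintype (Submodule F (Fin n → F)) := Fintype.ofFinite _
  have : Fintype (Points n F) := Fintype.ofFinite _
  have : IsProbabilityMeasure (randomPoints n F p) := by unfold randomPoints; infer_instance
  have hF : (1 : ℝ) ≤ Nat.card F := by exact_mod_cast (Finite.card_pos : 0 < Nat.card F)
  have hN0 : (0 : ℝ) < Nat.card (Points n F) := by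
    have : Nonempty (Fin n) := ⟨⟨0, hn⟩⟩
    exact_mod_cast (Finite.card_pos : 0 < Nat.card (Points n F))
  have hexp : Real.exp (-2 * (ε * Nat.card (Points n F)) ^ 2 / (Nat.card (Points n F) : ℕ)) =
      Real.exp (-(2 * ε ^ 2 * Nat.card (Points n F))) := by
    congr 1; field_simp
  have hcard : ∀ s : Finset (Points n F), s.card ≤ Nat.card (Points n F) := fun s => by
    rw [Nat.card_eq_fintype_card]; exact s.card_le_univ
  set N := Nat.card (Points n F)
  have hup : ∀ W : Submodule F (Fin n → F), (randomPoints n F p).real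
      {E | (p : ℝ) * (pointsOf W).card + ε * N ≤ ((E ∩ pointsOf W).ncard : ℝ)} ≤
      Real.exp (-(2 * ε ^ 2 * N)) := fun W =>
    hexp ▸ (setBernoulli_real_hoeffding p (pointsOf W) (hcard _) (mul_pos hε hN0)).1
  have hlow : (randomPoints n F p).real {E | (E.ncard : ℝ) ≤ p * N - ε * N} ≤
      Real.exp (-(2 * ε ^ 2 * N)) := by
    have h := (setBernoulli_real_hoeffding p (Finset.univ : Finset (Points n F)) (hcard _)
      (mul_pos hε hN0)).2
    rw [hexp, Finset.card_univ, ← Nat.card_eq_fintype_card, Finset.coe_univ] at h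
    simp only [Set.inter_univ] at h
    exact h
  have hsub : {E : Set (Points n F) | ¬ ((∀ W : Submodule F (Fin n → F),
        ((E ∩ pointsOf W).ncard : ℝ) ≤ p * (pointsOf W).card + ε * N) ∧
        (p - ε) * N ≤ (E.ncard : ℝ))} ⊆
      (⋃ W : Submodule F (Fin n → F),
        {E | (p : ℝ) * (pointsOf W).card + ε * N ≤ ((E ∩ pointsOf W).ncard : ℝ)}) ∪
      {E | (E.ncard : ℝ) ≤ p * N - ε * N} := by
    intro E hE
    simp only [Set.mem_ofPred_eq, not_and_or, not_forall, not_le] at hE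
    rcases hE with ⟨W, hW⟩ | hE
    · exact Or.inl (Set.mem_iUnion.2 ⟨W, hW.le⟩)
    · right
      simp only [Set.mem_ofPred_eq]
      linarith
  calc _ ≤ _ := measureReal_mono hsub
    _ ≤ _ := measureReal_union_le _ _
    _ ≤ Fintype.card (Submodule F (Fin n → F)) * Real.exp (-(2 * ε ^ 2 * N)) +
        Real.exp (-(2 * ε ^ 2 * N)) := by
      gcongr
      refine (measureReal_iUnion_fintype_le _).trans
        ((Finset.sum_le_sum fun W _ => hup W).trans_eq ?_)
      simp
    _ ≤ (Nat.card F : ℝ) ^ n ^ 2 * Real.exp (-(2 * ε ^ 2 * N)) +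
        (Nat.card F : ℝ) ^ n ^ 2 * Real.exp (-(2 * ε ^ 2 * N)) := by
      gcongr
      · rw [← Nat.card_eq_fintype_card]
        exact_mod_cast card_submodule_le
      · exact le_mul_of_one_le_left (Real.exp_nonneg _) (one_le_pow₀ hF)
    _ = _ := by ring

theorem tendsto_pow_sq_mul_exp_neg {Q c : ℝ} (hQ : 1 < Q) (hc : 0 < c) :
    Tendsto (fun n : ℕ => Q ^ n ^ 2 * Real.exp (-(c * (Q ^ n - 1)))) atTop (𝓝 0) := by
  -- The logarithm of the sequence is `Q ^ n * (n² / Q ^ n * log Q + (c / Q ^ n - c))`.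
  have h1 : Tendsto (fun n : ℕ => (n : ℝ) ^ 2 / Q ^ n * Real.log Q + (c / Q ^ n - c)) atTop
      (𝓝 (0 * Real.log Q + (0 - c))) :=
    ((tendsto_pow_const_div_const_pow_of_one_lt 2 hQ).mul_const _).add
      ((tendsto_const_nhds.div_atTop (tendsto_pow_atTop_atTop_of_one_lt hQ)).sub_const c)
  have h2 := (tendsto_pow_atTop_atTop_of_one_lt hQ).atTop_mul_neg (by linarith) h1
  refine (Real.tendsto_exp_atBot.comp h2).congr fun n => ?_
  have hQ0 : 0 < Q := by linarith
  have hexp : Q ^ n ^ 2 = Real.exp ((n : ℝ) ^ 2 * Real.log Q) := by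
    rw [← Nat.cast_pow, ← Real.log_pow, Real.exp_log (by positivity)]
  rw [hexp, ← Real.exp_add, Function.comp_apply]
  congr 1
  field_simp
  ring

theorem eventually_mul_le_mul_pow {Q a b : ℝ} (hQ : 1 < Q) (ha : 0 < a) (hb : 0 < b) :
    ∀ᶠ n : ℕ in atTop, a * n ≤ b * Q ^ n := by
  have h := tendsto_pow_const_div_const_pow_of_one_lt 1 hQ
  filter_upwards [h.eventually (eventually_le_nhds (div_pos hb ha))] with n hn
  rw [pow_one, div_le_div_iff₀ (by positivity) ha] at hn
  linarith

theorem eventually_mul_mul_pow_half_le {Q a b : ℝ} (hQ : 1 < Q) (ha : 0 < a) (hb : 0 < b) :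
    ∀ᶠ n : ℕ in atTop, a * n * Q ^ (n / 2) ≤ b * Q ^ n := by
  have ht : Tendsto (fun n : ℕ => n - n / 2) atTop atTop :=
    tendsto_atTop_atTop.2 fun m => ⟨2 * m, fun n hn => by omega⟩
  filter_upwards [ht.eventually
    (eventually_mul_le_mul_pow hQ (mul_pos two_pos ha) hb)] with n hn
  have hn2 : (n : ℝ) ≤ 2 * ((n - n / 2 : ℕ) : ℝ) := by
    exact_mod_cast (by omega : n ≤ 2 * (n - n / 2))
  calc a * n * Q ^ (n / 2) ≤ a * (2 * ((n - n / 2 : ℕ) : ℝ)) * Q ^ (n / 2) := by gcongr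
    _ = 2 * a * ((n - n / 2 : ℕ) : ℝ) * Q ^ (n / 2) := by ring
    _ ≤ b * Q ^ (n - n / 2) * Q ^ (n / 2) := by gcongr
    _ = b * Q ^ n := by rw [mul_assoc, ← pow_add, Nat.sub_add_cancel (Nat.div_le_self n 2)]

end Asymptotics

end RandomPG

theorem mainTheorem3 (q : ℕ) (hq : IsPrimePow q)
    (F : Type*) [Field F] [Finite F] (hF : Nat.card F = q)
    (p : unitInterval) (hp : 0 < p) (δ : ℝ) (hδ : 0 < δ) :
    Tendsto
      (fun n : ℕ => RandomPG.randomPoints n F p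
        {E : Set (RandomPG.Points n F) |
          (1 - δ) * ((p : ℝ) * ((q : ℝ) ^ n / (((q : ℝ) - 1) * (n : ℝ)))) ≤
              (RandomPG.colouringNumber ((RandomPG.PG n F).restrict E) : ℝ) ∧
            (RandomPG.colouringNumber ((RandomPG.PG n F).restrict E) : ℝ) ≤
              (1 + δ) * ((p : ℝ) * ((q : ℝ) ^ n / (((q : ℝ) - 1) * (n : ℝ))))})
      atTop (𝓝 1) := by
  subst hF
  have hQ : (1 : ℝ) < Nat.card F := by exact_mod_cast Finite.one_lt_card (α := F)
  have hp' : (0 : ℝ) < p := hp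
  have hε : 0 < δ * (p : ℝ) / 4 := by positivity
  have : ∀ n, MeasureTheory.IsProbabilityMeasure (RandomPG.randomPoints n F p) := fun n => by
    unfold RandomPG.randomPoints; infer_instance
  have hc : 0 < 2 * (δ * (p : ℝ) / 4) ^ 2 / ((Nat.card F : ℝ) - 1) :=
    div_pos (by positivity) (by linarith)
  have hlim : Tendsto (fun n : ℕ => 1 - 2 * ((Nat.card F : ℝ) ^ n ^ 2 *
      Real.exp (-(2 * (δ * (p : ℝ) / 4) ^ 2 / ((Nat.card F : ℝ) - 1) *
        ((Nat.card F : ℝ) ^ n - 1))))) atTop (𝓝 1) := by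
    simpa using ((RandomPG.tendsto_pow_sq_mul_exp_neg hQ hc).const_mul 2).const_sub 1
  rw [← ENNReal.tendsto_toReal_iff (fun n => MeasureTheory.measure_ne_top _ _) ENNReal.one_ne_top,
    ENNReal.toReal_one]
  refine tendsto_of_tendsto_of_tendsto_of_le_of_le' hlim tendsto_const_nhds ?_
    (Eventually.of_forall fun n => MeasureTheory.measureReal_le_one)
  filter_upwards [eventually_gt_atTop 0,
    RandomPG.eventually_mul_mul_pow_half_le hQ (sub_pos.2 hQ) hp',
    RandomPG.eventually_mul_le_mul_pow hQ (sub_pos.2 hQ) (by positivity : 0 < δ * (p : ℝ) / 2),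
    ((tendsto_pow_atTop_atTop_of_one_lt hQ).const_mul_atTop
      (half_pos hδ)).eventually_ge_atTop 1] with n hn h₁ h₂ h₃
  set A := {E : Set (RandomPG.Points n F) | _ ∧ _}
  rw [← MeasureTheory.measureReal_def, sub_le_iff_le_add]
  have hone : 1 ≤ (RandomPG.randomPoints n F p).real A +
      (RandomPG.randomPoints n F p).real Aᶜ := by
    rw [← MeasureTheory.probReal_univ (μ := RandomPG.randomPoints n F p),
      ← Set.union_compl_self A]
    exact MeasureTheory.measureReal_union_le _ _
  refine hone.trans (add_le_add le_rfl ?_)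
  have hbad := RandomPG.randomPoints_irregular_le n F p hε hn
  have hexp : 2 * (δ * (p : ℝ) / 4) ^ 2 * Nat.card (RandomPG.Points n F) =
      2 * (δ * (p : ℝ) / 4) ^ 2 / ((Nat.card F : ℝ) - 1) * ((Nat.card F : ℝ) ^ n - 1) := by
    have : (Nat.card F : ℝ) - 1 ≠ 0 := by linarith
    rw [← RandomPG.card_points_mul]
    field_simp
  rw [hexp] at hbad
  refine le_trans (MeasureTheory.measureReal_mono ?_) hbad
  -- A set of points all of whose counts are close to their means satisfies both bounds.
  intro E hE hreg
  exact hE ⟨RandomPG.le_colouringNumber_of_le_ncard hp'.le hδ.le hn E hreg.2 h₃,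
    RandomPG.colouringNumber_le_of_regular hp'.le hδ.le hn E hreg.1 h₁ (by linarith)⟩
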